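/- For real numbers $c_1,c_2$, let $\mathcal I_{c_1,c_2}$ be the set of finite sequences $D=(d_1,\dots,d_n)$ of non-negative integers (of any length $n$) with $c_1 n\le d_i\le c_2 n$ for all $i$. A bipartite realization of $D$ is a simple bipartite graph on vertices $v_1,\dots,v_n$ in which $v_i$ has degree $d_i$ for every $i$. The problem $\mathrm{BDR}_{c_1,c_2}$ has as its inputs the sequences in $\mathcal I_{c_1,c_2}$ (entries written in binary), and asks whether the input has a bipartite realization. Such a problem, with a prescribed set of inputs, is said to be in P if there is a Turing machine which on every one of its inputs gives the correct answer in a number of steps bounded by a polynomial in the length of the encoding of the input. We say that $D$ can be split into two parts of equal sum if $\sum_{i\in S}d_i=\sum_{i\notin S}d_i$ for some $S\subseteq\{1,\dots,n\}$. Theorem. (1) Suppose $0\le c_1\le c_2\le \frac{\sqrt{c_1(c_1+4)}-c_1}{2}$. Then a sequence $D\in\mathcal I_{c_1,c_2}$ has a bipartite realization if and only if it can be split into two parts of equal sum. Moreover, $\mathrm{BDR}_{c_1,c_2}$ is in P. (2) The problem whose inputs are the finite sequences $D=(d_1,\dots,d_n)$ of non-negative integers with $d_i\le n$ for all $i$,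 and which asks whether $D$ can be split into two parts of equal sum, is in P. (3) Suppose $c_1>\frac12$ and $c_1\le c_2$. Then no non-empty sequence in $\mathcal I_{c_1,c_2}$ has a bipartite realization, and $\mathrm{BDR}_{c_1,c_2}$ is in P. -/

import Mathlib

namespace BDR

open scoped Classical in
/-- The sequence `D` has a realization (a simple graph with one vertex per entry, whose degrees
are exactly the entries of `D`) that is a bipartite graph. -/
def HasBipartiteRealization (D : List ℕ) : Prop :=
  ∃ G : SimpleGraph (Fin D.length), G.IsBipartite ∧ ∀ i, G.degree i = D.get i

/-- The sequence `D` can be split into two parts (the entries at the positions in `S` and the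
remaining entries) of equal sum. -/
def HasEqualSumSplit (D : List ℕ) : Prop :=
  ∃ S : Finset (Fin D.length), ∑ i ∈ S, D.get i = ∑ i ∈ Sᶜ, D.get i

/-- The sequences of length `n` all of whose entries lie in `[c₁ n, c₂ n]`: these are the
instances of the problem `BDR_{c₁,c₂}`. -/
def Instances (c₁ c₂ : ℝ) : Set (List ℕ) :=
  {D | ∀ d ∈ D, c₁ * (D.length : ℝ) ≤ (d : ℝ) ∧ (d : ℝ) ≤ c₂ * (D.length : ℝ)}

/-- The word over `{0, 1, separator}` that encodes a sequence of natural numbers: the binary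
expansion of each entry, followed by the separator `none`. -/
def encodeSeq (D : List ℕ) : List (Option Bool) :=
  D.flatMap fun d => (Computability.encodeNat d).map some ++ [none]

open scoped Classical in
/-- The decision problem "given a sequence in `I` (in binary encoding), does it satisfy `Y`?" is
in P: some Turing machine decides it in time polynomial in the length of the encoding. -/
def InP (I : Set (List ℕ)) (Y : List ℕ → Prop) : Prop :=
  Nonempty (Turing.TM2ComputableInPolyTime (fun D : I => encodeSeq D.1)
    Computability.encodeBool (fun D : I => decide (Y D.1)))

end BDR

/-!
The two parts of a bipartite realization have equal degree sums, so a realization always splits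
the sequence; the content of the first claim is the converse. By the Gale–Ryser theorem
(`exists_finset_prod_card_eq`, deduced from Hall's marriage theorem), a split `S`, `Sᶜ` with common
sum `M` is realized by a bipartite graph as soon as all `K ⊆ S` and `L ⊆ Sᶜ` with `k` and `l` elements
satisfy `∑_K d + ∑_L d ≤ k l + M`. If all degrees lie between `p` and `q`, the left side is bounded
in terms of `k`, `l`, `p`, `q` and `M`, and these bounds suffice whenever `q² ≤ p (n - q)`
(`cut_inequality`). With `p = c₁ n` and `q = c₂ n` this is `c₂² ≤ c₁ (1 - c₂)`, which is what the
square root in the hypothesis expresses. If `c₁ > 1/2`, every vertex has more than `n / 2`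
neighbours in the opposite part, so both parts have more than `n / 2` elements, which is absurd.

For the complexity claims, the split problem with entries at most `n` is solved by dynamic
programming over the set of subset sums (`addEntry`, `bitAtHalf_foldl_addEntry`). All sums are at
most `n²`, hence polynomial in the input length even in unary, and an explicit machine with eight
stacks (`Split.machine`) runs the program in cubic time (`Split.runs_machine`). The hypothesis of
the first claim forces `c₂ ≤ 1`, so its realization problem is a restriction of the split problem.
When `c₁ > 1/2`, only the empty sequence is realizable, and a machine need only recognize it.
-/

namespace BDR

open Finset Turing

/-! ### Bipartite graphs with prescribed degrees -/

/-- The Gale–Ryser theorem, in its minimum-cut form: prescribed row sums `f` and column sums `g`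
with equal totals are realized by a 0/1 matrix (the set `E` of its ones) as soon as no set of
rows and columns violates the cut inequality.

This is Hall's marriage theorem for the cells of the matrix: row `a` asks for `f a` cells
of its own (the ones), and column `b` asks for `#α - g b` cells of its own (the zeros). The demands
add up to the number of cells, so a matching of the demands uses every cell exactly once. -/
theorem exists_finset_prod_card_eq {α β : Type*} [Fintype α] [Fintype β] [DecidableEq α]
    [DecidableEq β] (f : α → ℕ) (g : β → ℕ) (hfg : ∑ a, f a = ∑ b, g b)
    (h : ∀ (K : Finset α) (L : Finset β), ∑ a ∈ K, f a + ∑ b ∈ L, g b ≤ #K * #L + ∑ a, f a) :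
    ∃ E : Finset (α × β), (∀ a, #{b | (a, b) ∈ E} = f a) ∧ ∀ b, #{a | (a, b) ∈ E} = g b := by
  have hg : ∀ b, g b ≤ Fintype.card α := fun b => by
    have := h univ {b}
    simp only [sum_singleton, card_univ, card_singleton, mul_one] at this
    omega
  let t : (Σ a, Fin (f a)) ⊕ (Σ b, Fin (Fintype.card α - g b)) → Finset (α × β) :=
    Sum.elim (fun x => {x.1} ×ˢ univ) (fun y => univ ×ˢ {y.1})
  have hall : ∀ s, #s ≤ #(s.biUnion t) := by
    intro s
    set K : Finset α := univ.filter fun a => ∃ i, Sum.inl ⟨a, i⟩ ∈ s with hK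
    set L : Finset β := univ.filter fun b => ∃ j, Sum.inr ⟨b, j⟩ ∈ s with hL
    have h1 : #s ≤ ∑ a ∈ K, f a + ∑ b ∈ L, (Fintype.card α - g b) := by
      have hsub : s ⊆ (K.sigma fun a => (univ : Finset (Fin (f a)))).disjSum
          (L.sigma fun b => (univ : Finset (Fin (Fintype.card α - g b)))) := by
        rintro (⟨a, i⟩ | ⟨b, j⟩) hx
        · simpa [hK] using ⟨i, hx⟩
        · simpa [hL] using ⟨j, hx⟩
      simpa using card_le_card hsub
    have h2 : (Kᶜ ×ˢ Lᶜ)ᶜ ⊆ s.biUnion t := by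
      rintro ⟨a, b⟩ hab
      simp only [mem_compl, mem_product, not_and_or, not_not] at hab
      rw [mem_biUnion]
      rcases hab with ha | hb
      · obtain ⟨i, hi⟩ := (mem_filter.1 ha).2
        exact ⟨_, hi, by simp [t]⟩
      · obtain ⟨j, hj⟩ := (mem_filter.1 hb).2
        exact ⟨_, hj, by simp [t]⟩
    have h3 := card_le_card h2
    have h4 : #(Kᶜ ×ˢ Lᶜ)ᶜ + #Kᶜ * #Lᶜ = Fintype.card α * Fintype.card β := by
      rw [← card_product, card_compl_add_card, Fintype.card_prod]
    have h5 : ∑ b ∈ L, (Fintype.card α - g b) + ∑ b ∈ L, g b = #L * Fintype.card α := by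
      rw [← sum_add_distrib, sum_congr rfl fun b _ => Nat.sub_add_cancel (hg b), sum_const,
        smul_eq_mul]
    have h6 := h K Lᶜ
    have h7 : ∑ b ∈ L, g b + ∑ b ∈ Lᶜ, g b = ∑ b, g b := sum_add_sum_compl L g
    have h8 := card_add_card_compl K
    have h9 := card_add_card_compl L
    have h10 : #K * #Lᶜ + #Kᶜ * #Lᶜ + #L * Fintype.card α
        = Fintype.card α * Fintype.card β := by
      rw [← h9, ← add_mul, h8]; ring
    omega
  obtain ⟨φ, hφ, hφt⟩ := (all_card_le_biUnion_card_iff_exists_injective t).1 hall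
  have hcard : Fintype.card ((Σ a, Fin (f a)) ⊕ (Σ b, Fin (Fintype.card α - g b)))
      = Fintype.card (α × β) := by
    have h5 : ∑ b, (Fintype.card α - g b) + ∑ b, g b = Fintype.card β * Fintype.card α := by
      rw [← sum_add_distrib, sum_congr rfl fun b _ => Nat.sub_add_cancel (hg b), sum_const,
        smul_eq_mul, card_univ]
    simp only [Fintype.card_sum, Fintype.card_sigma, Fintype.card_fin, Fintype.card_prod]
    rw [mul_comm]
    omega
  have hbij : Function.Bijective φ := (Fintype.bijective_iff_injective_and_card φ).2 ⟨hφ, hcard⟩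
  have hl : ∀ a i, (φ (Sum.inl ⟨a, i⟩)).1 = a := fun a i =>
    (mem_singleton.1 (mem_product.1 (hφt (Sum.inl ⟨a, i⟩))).1)
  have hr : ∀ b j, (φ (Sum.inr ⟨b, j⟩)).2 = b := fun b j =>
    (mem_singleton.1 (mem_product.1 (hφt (Sum.inr ⟨b, j⟩))).2)
  refine ⟨univ.image fun x => φ (Sum.inl x), fun a => ?_, fun b => ?_⟩
  · have : (univ.filter fun b => (a, b) ∈ univ.image fun x => φ (Sum.inl x))
        = univ.image fun i : Fin (f a) => (φ (Sum.inl ⟨a, i⟩)).2 := by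
      ext b
      simp only [mem_filter, mem_univ, true_and, mem_image]
      constructor
      · rintro ⟨⟨a', i⟩, hi⟩
        obtain rfl : a' = a := by rw [← hl a' i, hi]
        exact ⟨i, by rw [hi]⟩
      · rintro ⟨i, hi⟩
        exact ⟨⟨a, i⟩, Prod.ext (hl a i) hi⟩
    rw [this, card_image_of_injective, card_univ, Fintype.card_fin]
    intro i j hij
    have := hφ (Prod.ext ((hl a i).trans (hl a j).symm) hij)
    simpa using this
  · have : (univ.filter fun a => (a, b) ∈ univ.image fun x => φ (Sum.inl x))ᶜ
        = univ.image fun j : Fin (Fintype.card α - g b) => (φ (Sum.inr ⟨b, j⟩)).1 := by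
      ext a
      simp only [mem_compl, mem_filter, mem_univ, true_and, mem_image]
      constructor
      · intro hab
        obtain ⟨x | ⟨b', j⟩, hx⟩ := hbij.2 (a, b)
        · exact absurd ⟨x, hx⟩ hab
        · obtain rfl : b' = b := by rw [← hr b' j, hx]
          exact ⟨j, by rw [hx]⟩
      · rintro ⟨j, hj⟩ ⟨x, hx⟩
        have : φ (Sum.inr ⟨b, j⟩) = φ (Sum.inl x) := by
          rw [hx]; exact Prod.ext hj (hr b j)
        simpa using hφ this
    have h2 := congrArg Finset.card this
    rw [card_image_of_injective, card_univ, Fintype.card_fin, card_compl] at h2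
    · have h3 := hg b
      have h4 := card_le_univ (univ.filter fun a => (a, b) ∈ univ.image fun x => φ (Sum.inl x))
      omega
    intro i j hij
    have := hφ (Prod.ext hij ((hr b i).trans (hr b j).symm))
    simpa using this

/-- If `S` splits the degree sequence `d` into parts of equal sum and the cut inequality holds
for all subsets of the two parts, then `d` is realized by a bipartite graph with parts
`S` and `Sᶜ`. -/
theorem exists_isBipartite_degree_eq {V : Type*} [Fintype V] [DecidableEq V] (d : V → ℕ)
    (S : Finset V)
    (hS : ∑ i ∈ S, d i = ∑ i ∈ Sᶜ, d i)
    (h : ∀ K ⊆ S, ∀ L ⊆ Sᶜ, ∑ i ∈ K, d i + ∑ i ∈ L, d i ≤ #K * #L + ∑ i ∈ S, d i) :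
    ∃ G : SimpleGraph V, G.IsBipartite ∧ ∀ i [Fintype (G.neighborSet i)], G.degree i = d i := by
  obtain ⟨E, hE1, hE2⟩ := exists_finset_prod_card_eq
    (fun i => if i ∈ S then d i else 0) (fun i => if i ∈ Sᶜ then d i else 0)
    (by simpa only [sum_ite_mem, univ_inter] using hS) (by
      intro K L
      simp only [sum_ite_mem, univ_inter]
      refine (h _ inter_subset_right _ inter_subset_right).trans ?_
      gcongr <;> exact inter_subset_left)
  -- rows outside `S` and columns inside `S` have sum zero
  have hE : ∀ u v, (u, v) ∈ E → u ∈ S ∧ v ∉ S := by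
    intro u v huv
    constructor
    · by_contra hu
      have := hE1 u
      rw [if_neg hu, card_eq_zero] at this
      exact absurd (mem_filter.2 ⟨mem_univ v, huv⟩) (this ▸ notMem_empty v)
    · intro hv
      have := hE2 v
      rw [if_neg (by simpa using hv), card_eq_zero] at this
      exact absurd (mem_filter.2 ⟨mem_univ u, huv⟩) (this ▸ notMem_empty u)
  let G : SimpleGraph V :=
    { Adj := fun u v => (u, v) ∈ E ∨ (v, u) ∈ E
      symm := ⟨fun _ _ huv => huv.symm⟩
      loopless := ⟨fun u hu => by
        have := hE u u (hu.elim id id)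
        exact this.2 this.1⟩ }
  refine ⟨G, ?_, fun i _ => ?_⟩
  · refine SimpleGraph.IsBipartiteWith.isBipartite (s := (S : Set V)) (t := ((Sᶜ : Finset V) : Set V))
      ⟨?_, ?_⟩
    · rw [Finset.disjoint_coe]; exact disjoint_compl_right
    · rintro u v (huv | huv)
      · simpa using Or.inl (hE _ _ huv)
      · simpa using Or.inr (hE _ _ huv).symm
  · rw [← SimpleGraph.card_neighborFinset_eq_degree]
    by_cases hi : i ∈ S
    · rw [← if_pos (c := i ∈ S) (t := d i) (e := 0) hi, ← hE1 i]
      congr 1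
      ext v
      simp only [SimpleGraph.mem_neighborFinset, mem_filter, mem_univ, true_and, G]
      exact ⟨fun hv => hv.resolve_right fun hv => (hE _ _ hv).2 hi, Or.inl⟩
    · rw [← if_pos (c := i ∈ Sᶜ) (t := d i) (e := 0) (mem_compl.2 hi), ← hE2 i]
      congr 1
      ext v
      simp only [SimpleGraph.mem_neighborFinset, mem_filter, mem_univ, true_and, G]
      exact ⟨fun hv => hv.resolve_left fun hv => hi (hE _ _ hv).1, Or.inr⟩

theorem HasBipartiteRealization.hasEqualSumSplit {D : List ℕ} (h : HasBipartiteRealization D) :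
    HasEqualSumSplit D := by
  classical
  obtain ⟨G, hG, hD⟩ := h
  obtain ⟨s, t, hst⟩ := hG.exists_isBipartiteWith
  -- the second part need not be `t`: isolated vertices may lie in neither `s` nor `t`
  refine ⟨s.toFinset, ?_⟩
  have hst' : G.IsBipartiteWith (s.toFinset : Set _) (t.toFinset : Set _) := by simpa using hst
  have h1 := SimpleGraph.isBipartiteWith_sum_degrees_eq hst'
  have h2 : ∑ v ∈ t.toFinset, G.degree v = ∑ v ∈ s.toFinsetᶜ, G.degree v := by
    refine sum_subset (fun v hv => ?_) (fun v hv hvt => ?_)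
    · rw [mem_compl, Set.mem_toFinset]
      exact fun hs => Set.disjoint_left.1 hst.disjoint hs (Set.mem_toFinset.1 hv)
    · rw [← SimpleGraph.card_neighborFinset_eq_degree, card_eq_zero, eq_empty_iff_forall_notMem]
      intro w hw
      rw [SimpleGraph.mem_neighborFinset] at hw
      rcases hst.mem_of_adj hw with hh | hh
      · exact (mem_compl.1 hv) (Set.mem_toFinset.2 hh.1)
      · exact hvt (Set.mem_toFinset.2 hh.1)
  have h3 : ∀ i, G.degree i = D.get i := fun i => by convert hD i
  simp only [← h3]
  exact h1.trans h2

/-- The cut inequality for degrees between `p` and `q` on a vertex set of size `a + b`, when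
`q² ≤ p (a + b - q)`. Here `x` and `y` are the degree sums of `k` of the `a` vertices of
one part and of `l` of the `b` vertices of the other part, and `M` is the total of each part. -/
theorem cut_inequality {p q a b k l x y M : ℝ} (hp : 0 ≤ p) (hpq : p ≤ q)
    (hq : q * q ≤ p * (a + b - q)) (hk : 0 ≤ k) (hl : 0 ≤ l)
    (hx : x ≤ k * q) (hy : y ≤ l * q) (hxM : x + (a - k) * p ≤ M) (hyM : y + (b - l) * p ≤ M)
    (hxM' : x ≤ M) (hyM' : y ≤ M) : x + y ≤ k * l + M := by
  -- if `k ≥ q`, then already `y ≤ l q ≤ k l`; similarly for `l ≥ q`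
  rcases le_or_gt q k with hqk | hqk
  · nlinarith
  rcases le_or_gt q l with hql | hql
  · nlinarith
  -- otherwise adding the two failing estimates contradicts `q² ≤ p (a + b - q)`, since
  -- `(k + l) (p + q) - 2 k l` is at most `q² + p q` on the square `[0, q]²`
  by_contra! hlt
  have h1 : (a - k) * p < l * (q - k) := by linarith
  have h2 : (b - l) * p < k * (q - l) := by linarith
  have hu : 0 ≤ (q - k) * (q - l) := mul_nonneg (by linarith) (by linarith)
  have hv : 0 ≤ k * l := mul_nonneg hk hl
  have hw1 : 0 ≤ k * (q - l) := mul_nonneg hk (by linarith)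
  have hw2 : 0 ≤ l * (q - k) := mul_nonneg hl (by linarith)
  have hq0 : 0 < q := by linarith
  have h3 : (k + l) * (p + q) - 2 * (k * l) ≤ q * q + p * q := by
    nlinarith [mul_nonneg (sub_nonneg.2 hpq) hu, mul_nonneg hp hu]
  nlinarith

/-- Any split into equal sums can serve as the bipartition. -/
theorem HasEqualSumSplit.hasBipartiteRealization {c₁ c₂ : ℝ} (h0 : 0 ≤ c₁) (h12 : c₁ ≤ c₂)
    (h : c₂ * c₂ ≤ c₁ * (1 - c₂)) {D : List ℕ} (hD : D ∈ Instances c₁ c₂)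
    (hS : HasEqualSumSplit D) : HasBipartiteRealization D := by
  obtain ⟨S, hS⟩ := hS
  suffices hcut : ∀ K ⊆ S, ∀ L ⊆ Sᶜ,
      ∑ i ∈ K, D.get i + ∑ i ∈ L, D.get i ≤ #K * #L + ∑ i ∈ S, D.get i by
    obtain ⟨G, hG, hdeg⟩ := exists_isBipartite_degree_eq D.get S hS hcut
    refine ⟨G, hG, fun i => ?_⟩
    convert @hdeg i (Fintype.ofFinite _)
  intro K hK L hL
  have hlo : ∀ i, c₁ * (D.length : ℝ) ≤ (D.get i : ℝ) := fun i => (hD _ (D.get_mem i)).1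
  have hhi : ∀ i, (D.get i : ℝ) ≤ c₂ * (D.length : ℝ) := fun i => (hD _ (D.get_mem i)).2
  have hn : (0 : ℝ) ≤ D.length := Nat.cast_nonneg _
  have upper : ∀ A : Finset (Fin D.length),
      ((∑ i ∈ A, D.get i : ℕ) : ℝ) ≤ #A * (c₂ * (D.length : ℝ)) := fun A => by
    push_cast
    simpa using sum_le_card_nsmul A (fun i => (D.get i : ℝ)) _ fun i _ => hhi i
  have lower : ∀ A B : Finset (Fin D.length), A ⊆ B →
      ((∑ i ∈ A, D.get i : ℕ) : ℝ) + ((#B : ℝ) - #A) * (c₁ * (D.length : ℝ))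
        ≤ ((∑ i ∈ B, D.get i : ℕ) : ℝ) := fun A B hAB => by
    have h1 := card_nsmul_le_sum (B \ A) (fun i => (D.get i : ℝ)) _ fun i _ => hlo i
    rw [nsmul_eq_mul, card_sdiff_of_subset hAB, Nat.cast_sub (card_le_card hAB)] at h1
    have h2 := sum_sdiff (f := fun i => (D.get i : ℝ)) hAB
    push_cast
    linarith
  have mono : ∀ A B : Finset (Fin D.length), A ⊆ B →
      ((∑ i ∈ A, D.get i : ℕ) : ℝ) ≤ ((∑ i ∈ B, D.get i : ℕ) : ℝ) := fun A B hAB => by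
    exact_mod_cast sum_le_sum_of_subset hAB
  have hcard : (#S : ℝ) + #Sᶜ = D.length := by
    exact_mod_cast (card_add_card_compl S).trans (Fintype.card_fin _)
  have hL1 := lower L _ hL
  have hL2 := mono L _ hL
  rw [← hS] at hL1 hL2
  have key := cut_inequality (a := #S) (b := #Sᶜ) (mul_nonneg h0 hn) (mul_le_mul_of_nonneg_right h12 hn)
    (by rw [hcard]; nlinarith [mul_le_mul_of_nonneg_right h (mul_nonneg hn hn)])
    (Nat.cast_nonneg #K) (Nat.cast_nonneg #L) (upper K) (upper L) (lower K S hK) hL1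
    (mono K S hK) hL2
  exact_mod_cast key

/-- The bound on `c₂` says that `c₂` is at most the positive root of `x² = c₁ (1 - x)`. -/
theorem mul_self_le_of_le_sqrt {c₁ c₂ : ℝ} (h0 : 0 ≤ c₁) (h12 : c₁ ≤ c₂)
    (h : c₂ ≤ (√(c₁ * (c₁ + 4)) - c₁) / 2) : c₂ * c₂ ≤ c₁ * (1 - c₂) := by
  have h1 : 2 * c₂ + c₁ ≤ √(c₁ * (c₁ + 4)) := by linarith
  have h2 := (Real.le_sqrt (by linarith) (by positivity)).1 h1
  nlinarith

theorem not_hasBipartiteRealization {c₁ c₂ : ℝ} (h : 1 / 2 < c₁) {D : List ℕ}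
    (hD : D ∈ Instances c₁ c₂) (hne : D ≠ []) : ¬ HasBipartiteRealization D := by
  classical
  rintro ⟨G, hG, hdeg⟩
  obtain ⟨s, t, hst⟩ := hG.exists_isBipartiteWith
  have hst' : G.IsBipartiteWith (s.toFinset : Set _) (t.toFinset : Set _) := by simpa using hst
  have hn : 0 < D.length := List.length_pos_iff.2 hne
  -- every degree exceeds half the number of vertices
  have hbig : ∀ v, D.length < 2 * G.degree v := fun v => by
    have h1 : G.degree v = D.get v := by convert hdeg v
    have h2 := (hD _ (D.get_mem v)).1
    rw [← h1] at h2
    have h3 : (0 : ℝ) < D.length := by exact_mod_cast hn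
    have : (D.length : ℝ) < 2 * G.degree v := by nlinarith
    exact_mod_cast this
  have hdis : Disjoint s.toFinset t.toFinset := by simpa using hst.disjoint
  have hcard : #s.toFinset + #t.toFinset ≤ D.length := by
    rw [← card_union_of_disjoint hdis]
    simpa using card_le_univ (s.toFinset ∪ t.toFinset)
  obtain ⟨w, hw⟩ : ∃ w, G.Adj ⟨0, hn⟩ w := by
    have := hbig ⟨0, hn⟩
    rw [← G.degree_pos_iff_exists_adj]
    omega
  rcases hst'.mem_of_adj hw with ⟨h1, h2⟩ | ⟨h1, h2⟩
  · have := SimpleGraph.isBipartiteWith_degree_le hst' h1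
    have := SimpleGraph.isBipartiteWith_degree_le' hst' h2
    have := hbig ⟨0, hn⟩
    have := hbig w
    omega
  · have := SimpleGraph.isBipartiteWith_degree_le' hst' h1
    have := SimpleGraph.isBipartiteWith_degree_le hst' h2
    have := hbig ⟨0, hn⟩
    have := hbig w
    omega

theorem hasBipartiteRealization_nil : HasBipartiteRealization [] :=
  ⟨⊥, ⟨fun i => i.elim0, fun {i} => i.elim0⟩, fun i => i.elim0⟩

/-! ### Subset sums -/

/-- `s` is the sum of the entries of `D` at some set of positions. -/
def IsSubsetSum (D : List ℕ) (s : ℕ) : Prop :=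
  ∃ S : Finset (Fin D.length), ∑ i ∈ S, D.get i = s

theorem isSubsetSum_nil {s : ℕ} : IsSubsetSum [] s ↔ s = 0 := by
  constructor
  · rintro ⟨S, rfl⟩
    exact sum_eq_zero fun i => i.elim0
  · rintro rfl
    exact ⟨∅, rfl⟩

theorem isSubsetSum_cons {d : ℕ} {D : List ℕ} {s : ℕ} :
    IsSubsetSum (d :: D) s ↔ IsSubsetSum D s ∨ ∃ t, IsSubsetSum D t ∧ s = d + t := by
  constructor
  · rintro ⟨S, hS⟩
    have key : ∑ i ∈ S, (d :: D).get i = (if (0 : Fin (D.length + 1)) ∈ S then d else 0)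
        + ∑ i ∈ univ.filter (fun i : Fin D.length => i.succ ∈ S), D.get i := by
      have hS' : S = univ.filter (· ∈ S) := by simp
      conv_lhs => rw [hS', sum_filter]
      rw [sum_filter]
      exact Fin.sum_univ_succ fun i : Fin (D.length + 1) => if i ∈ S then (d :: D).get i else 0
    rw [hS] at key
    split_ifs at key with h
    · exact Or.inr ⟨_, ⟨_, rfl⟩, key⟩
    · exact Or.inl ⟨_, by rw [key, zero_add]⟩
  · rintro (⟨S, rfl⟩ | ⟨_, ⟨S, rfl⟩, rfl⟩)
    · exact ⟨S.map (Fin.succEmb _), by rw [sum_map]; rfl⟩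
    · refine ⟨cons (0 : Fin (D.length + 1)) (S.map (Fin.succEmb _)) ?_, ?_⟩
      · simp [Fin.succ_ne_zero]
      · rw [sum_cons, sum_map]; rfl

theorem hasEqualSumSplit_iff {D : List ℕ} :
    HasEqualSumSplit D ↔ ∃ s, IsSubsetSum D s ∧ 2 * s = D.sum := by
  have key : ∀ S : Finset (Fin D.length),
      ∑ i ∈ S, D.get i + ∑ i ∈ Sᶜ, D.get i = D.sum := fun S => by
    rw [sum_add_sum_compl, ← List.sum_ofFn, List.ofFn_get]
  constructor
  · rintro ⟨S, hS⟩
    exact ⟨_, ⟨S, rfl⟩, by rw [← key S]; omega⟩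
  · rintro ⟨_, ⟨S, rfl⟩, hS⟩
    exact ⟨S, by have := key S; omega⟩

/-- The entrywise disjunction of two bit lists, with the length of the first; the second one is
padded with `false`. -/
def zipOr : List Bool → List Bool → List Bool
  | [], _ => []
  | s :: S, R => (s || R.head? == some true) :: zipOr S R.tail

@[simp]
theorem length_zipOr (S R : List Bool) : (zipOr S R).length = S.length := by
  induction S generalizing R with
  | nil => rfl
  | cons s S ih => simp [zipOr, ih]

theorem getElem?_zipOr {S R : List Bool} (h : R.length ≤ S.length) (i : ℕ) :
    (zipOr S R)[i]? = some true ↔ S[i]? = some true ∨ R[i]? = some true := by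
  induction S generalizing R i with
  | nil => simp_all [zipOr]
  | cons s S ih =>
    cases i with
    | zero => cases R <;> simp [zipOr]
    | succ i =>
      have := ih (R := R.tail) (by simpa using h) i
      cases R <;> simp_all [zipOr]

/-- One step of the dynamic program for subset sums: if the bits of `R` mark the sums reachable
so far, those of `addEntry R d` mark the sums reachable with the further entry `d`. -/
def addEntry (R : List Bool) (d : ℕ) : List Bool :=
  zipOr (List.replicate d false ++ R) R

@[simp]
theorem length_addEntry (R : List Bool) (d : ℕ) : (addEntry R d).length = d + R.length := by
  simp [addEntry]

theorem length_foldl_addEntry (R : List Bool) (D : List ℕ) :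
    (D.foldl addEntry R).length = D.sum + R.length := by
  induction D generalizing R with
  | nil => simp
  | cons d D ih => simp [ih]; omega

theorem getElem?_addEntry (R : List Bool) (d i : ℕ) :
    (addEntry R d)[i]? = some true ↔
      R[i]? = some true ∨ ∃ j, R[j]? = some true ∧ i = d + j := by
  rw [addEntry, getElem?_zipOr (by simp), or_comm]
  refine or_congr_right ?_
  rcases lt_or_ge i d with h | h
  · rw [List.getElem?_append_left (by simpa using h), List.getElem?_replicate, if_pos h]
    constructor
    · simp
    · rintro ⟨j, -, hj⟩; omega
  · rw [List.getElem?_append_right (by simpa using h), List.length_replicate]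
    constructor
    · exact fun hi => ⟨i - d, hi, by omega⟩
    · rintro ⟨j, hj, rfl⟩
      rwa [Nat.add_sub_cancel_left]

theorem getElem?_foldl_addEntry (R : List Bool) (D : List ℕ) (i : ℕ) :
    (D.foldl addEntry R)[i]? = some true ↔
      ∃ j s, R[j]? = some true ∧ IsSubsetSum D s ∧ i = j + s := by
  induction D generalizing R with
  | nil => simp [isSubsetSum_nil]
  | cons d D ih =>
    rw [List.foldl_cons, ih]
    simp only [getElem?_addEntry, isSubsetSum_cons]
    constructor
    · rintro ⟨j, s, hj | ⟨j, hj, rfl⟩, hs, rfl⟩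
      · exact ⟨j, s, hj, Or.inl hs, rfl⟩
      · exact ⟨j, d + s, hj, Or.inr ⟨s, hs, rfl⟩, by omega⟩
    · rintro ⟨j, s, hj, hs | ⟨s, hs, rfl⟩, rfl⟩
      · exact ⟨j, s, Or.inl hj, hs, rfl⟩
      · exact ⟨d + j, s, Or.inr ⟨j, hj, rfl⟩, hs, by omega⟩

/-- The bit that sits at half of the index `n`, and `false` if `n` is odd. -/
def bitAtHalf : ℕ → List Bool → Bool
  | 0, R => R.head? == some true
  | 1, _ => false
  | n + 2, R => bitAtHalf n R.tail

theorem bitAtHalf_eq_true {n : ℕ} {R : List Bool} :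
    bitAtHalf n R = true ↔ ∃ s, R[s]? = some true ∧ 2 * s = n := by
  induction n, R using bitAtHalf.induct with
  | case1 R => simp [bitAtHalf, List.head?_eq_getElem?]
  | case2 R => simp [bitAtHalf]
  | case3 n R ih =>
    rw [bitAtHalf, ih]
    constructor
    · rintro ⟨s, hs, rfl⟩
      exact ⟨s + 1, by simpa using hs, by omega⟩
    · rintro ⟨s, hs, hn⟩
      obtain ⟨s, rfl⟩ : ∃ t, s = t + 1 := ⟨s - 1, by omega⟩
      exact ⟨s, by simpa using hs, by omega⟩

theorem bitAtHalf_foldl_addEntry {D : List ℕ} :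
    bitAtHalf D.sum (D.foldl addEntry [true]) = true ↔ HasEqualSumSplit D := by
  rw [bitAtHalf_eq_true, hasEqualSumSplit_iff]
  refine exists_congr fun s => and_congr_left fun _ => ?_
  rw [getElem?_foldl_addEntry]
  constructor
  · rintro ⟨j, t, hj, ht, rfl⟩
    obtain rfl : j = 0 := by
      by_contra h
      obtain ⟨k, rfl⟩ := Nat.exists_eq_succ_of_ne_zero h
      simp at hj
    rwa [zero_add]
  · exact fun hs => ⟨0, s, rfl, hs, (zero_add s).symm⟩

/-! ### Binary expansions -/

/-- The number with the given binary digits, least significant digit first. -/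
def ofBits : List Bool → ℕ
  | [] => 0
  | b :: l => b.toNat + 2 * ofBits l

theorem ofBits_encodePosNum (n : PosNum) : ofBits (Computability.encodePosNum n) = n := by
  induction n with
  | one => rfl
  | bit0 n ih => rw [Computability.encodePosNum, ofBits, ih, PosNum.cast_bit0]; simp; omega
  | bit1 n ih => rw [Computability.encodePosNum, ofBits, ih, PosNum.cast_bit1]; simp; omega

/-- The leading digit is `1`, so the weights of the digits stay linear in the number. -/
theorem two_pow_length_encodePosNum_le (n : PosNum) :
    2 ^ (Computability.encodePosNum n).length ≤ 2 * (n : ℕ) := by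
  induction n with
  | one => simp [Computability.encodePosNum]
  | bit0 n ih => rw [Computability.encodePosNum, List.length_cons, pow_succ, PosNum.cast_bit0]; omega
  | bit1 n ih => rw [Computability.encodePosNum, List.length_cons, pow_succ, PosNum.cast_bit1]; omega

theorem ofBits_encodeNat (d : ℕ) : ofBits (Computability.encodeNat d) = d := by
  conv_rhs => rw [← Num.to_of_nat d]
  rw [Computability.encodeNat]
  cases (d : Num) with
  | zero => rfl
  | pos n => exact ofBits_encodePosNum n

theorem two_pow_length_encodeNat_le (d : ℕ) :
    2 ^ (Computability.encodeNat d).length ≤ 2 * d + 1 := by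
  conv_rhs => rw [← Num.to_of_nat d]
  rw [Computability.encodeNat]
  cases (d : Num) with
  | zero => simp [Computability.encodeNum]
  | pos n => exact (two_pow_length_encodePosNum_le n).trans (Nat.le_succ _)

theorem length_le_length_encodeSeq (D : List ℕ) : D.length ≤ (encodeSeq D).length := by
  induction D with
  | nil => simp
  | cons d D ih =>
    rw [encodeSeq] at ih
    simp only [encodeSeq, List.flatMap_cons, List.length_append, List.length_cons]
    simp only [List.length_map, List.length_nil]
    omega

/-! ### Runs of stack machines in bounded time -/

/-- The machine `tm` gets from `c` to `c'` in at most `n` steps. -/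
def Runs (tm : FinTM2) (n : ℕ) (c c' : tm.Cfg) : Prop :=
  ∃ k ≤ n, (flip bind tm.step)^[k] (some c) = some c'

theorem Runs.refl {tm : FinTM2} (c : tm.Cfg) : Runs tm 0 c c := ⟨0, le_rfl, rfl⟩

theorem Runs.mono {tm : FinTM2} {m n : ℕ} {c c' : tm.Cfg} (h : Runs tm m c c') (hmn : m ≤ n) :
    Runs tm n c c' :=
  h.imp fun _ hk => ⟨hk.1.trans hmn, hk.2⟩

theorem Runs.trans {tm : FinTM2} {m n : ℕ} {c c' c'' : tm.Cfg} (h : Runs tm m c c')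
    (h' : Runs tm n c' c'') : Runs tm (m + n) c c'' := by
  obtain ⟨k, hk, e⟩ := h
  obtain ⟨l, hl, e'⟩ := h'
  exact ⟨l + k, by omega, by rw [Function.iterate_add_apply, e, e']⟩

theorem Runs.step {tm : FinTM2} {c c' : tm.Cfg} (h : tm.step c = some c') : Runs tm 1 c c' :=
  ⟨1, le_rfl, h⟩

/-- A machine whose runs end with a bit that answers the question puts the problem in P. -/
theorem inP_of_runs {I : Set (List ℕ)} {Y : List ℕ → Prop} (tm : FinTM2)
    (e₀ : tm.Γ tm.k₀ ≃ Option Bool) (e₁ : tm.Γ tm.k₁ ≃ Bool) (p : Polynomial ℕ)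
    (h : ∀ D ∈ I, ∃ b : Bool, (b = true ↔ Y D) ∧ Runs tm (p.eval (encodeSeq D).length)
      (initList tm ((encodeSeq D).map e₀.symm)) (haltList tm [e₁.symm b])) :
    InP I Y := by
  classical
  have h' : ∀ D ∈ I, Runs tm (p.eval (encodeSeq D).length)
      (initList tm ((encodeSeq D).map e₀.symm)) (haltList tm [e₁.symm (decide (Y D))]) := by
    intro D hD
    obtain ⟨b, hb, hr⟩ := h D hD
    rwa [show decide (Y D) = b by rw [Bool.eq_iff_iff, hb, decide_eq_true_iff]]
  exact ⟨{
    tm := tm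
    inputAlphabet := e₀
    outputAlphabet := e₁
    time := p
    outputsFun := fun D =>
      { steps := (h' D.1 D.2).choose
        evals_in_steps := (h' D.1 D.2).choose_spec.2
        steps_le_m := (h' D.1 D.2).choose_spec.1 } }⟩

theorem InP.congr {I : Set (List ℕ)} {Y Y' : List ℕ → Prop} (h : InP I Y)
    (hY : ∀ D ∈ I, Y D ↔ Y' D) : InP I Y' := by
  classical
  unfold InP at h ⊢
  convert h using 3
  exact (decide_eq_decide.2 (hY _ (Subtype.prop _))).symm

/-- Restricting the inputs keeps a problem in P. -/
theorem InP.mono {I I' : Set (List ℕ)} {Y : List ℕ → Prop} (h : InP I Y) (hI : I' ⊆ I) :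
    InP I' Y := by
  obtain ⟨h⟩ := h
  exact ⟨{ h with outputsFun := fun D => h.outputsFun ⟨D.1, hI D.2⟩ }⟩

/-! ### A machine recognizing the empty sequence -/

/-- The stack alphabets of a machine with an input stack (`false`) and an output stack (`true`). -/
def EmptyTest.Alphabet : Bool → Type
  | false => Option Bool
  | true => Bool

/-- The machine that accepts exactly the empty word. Its label tells whether a letter has been
read. -/
def emptyTest : FinTM2 where
  K := Bool
  k₀ := false
  k₁ := true
  Γ := EmptyTest.Alphabet
  Λ := Bool
  main := false
  σ := Bool
  initialState := false
  Γk₀Fin := inferInstanceAs (Fintype (Option Bool))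
  m l := .pop false (fun _ a => a.isSome) <|
    .branch id (.goto fun _ => true) (.push true (fun _ => (!l : Bool)) .halt)

/-- The configurations of `emptyTest`. -/
def emptyTestCfg (l : Option Bool) (v : Bool) (inp : List (Option Bool)) (out : List Bool) :
    emptyTest.Cfg where
  l := l
  var := v
  stk
    | false => inp
    | true => out

theorem emptyTest_step {l v v' : Bool} {l' : Option Bool} {inp inp' : List (Option Bool)}
    {out out' : List Bool} {c : TM2.Cfg EmptyTest.Alphabet Bool Bool}
    (h : TM2.stepAux (emptyTest.m l) v (emptyTestCfg (some l) v inp out).stk = c)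
    (hl : c.l = l') (hv : c.var = v') (hi : c.stk false = inp') (ho : c.stk true = out') :
    Runs emptyTest 1 (emptyTestCfg (some l) v inp out) (emptyTestCfg l' v' inp' out') := by
  refine Runs.step (congrArg some (h.trans ?_))
  obtain ⟨l₁, v₁, s⟩ := c
  obtain rfl : l₁ = l' := hl
  obtain rfl : v₁ = v' := hv
  refine congrArg (TM2.Cfg.mk l₁ v₁) (funext fun k => ?_)
  cases k <;> assumption

theorem emptyTest_runs (l v : Bool) (inp : List (Option Bool)) :
    Runs emptyTest (inp.length + 1) (emptyTestCfg (some l) v inp [])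
      (emptyTestCfg none false [] [!l && inp.isEmpty]) := by
  induction inp generalizing l v with
  | nil =>
    cases l <;> exact emptyTest_step rfl rfl rfl rfl rfl
  | cons a inp ih =>
    have h : Runs emptyTest 1 (emptyTestCfg (some l) v (a :: inp) [])
        (emptyTestCfg (some true) true inp []) :=
      emptyTest_step rfl rfl rfl rfl rfl
    have h' := (h.trans (ih true true)).mono (n := (a :: inp).length + 1) (by simp; omega)
    simpa using h'

theorem encodeSeq_eq_nil {D : List ℕ} : encodeSeq D = [] ↔ D = [] := by
  cases D <;> simp [encodeSeq]

theorem inP_eq_nil (I : Set (List ℕ)) : InP I (· = []) := by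
  classical
  refine inP_of_runs emptyTest (Equiv.refl _) (Equiv.refl _) (Polynomial.X + 1) fun D _ =>
    ⟨(encodeSeq D).isEmpty, by rw [List.isEmpty_iff, encodeSeq_eq_nil], ?_⟩
  convert emptyTest_runs false false (encodeSeq D) using 1
  · simp
  · refine congrArg (TM2.Cfg.mk (some false) false) (funext fun k => ?_)
    cases k
    · exact List.map_id _
    · rfl
  · refine congrArg (TM2.Cfg.mk none false) (funext fun k => ?_)
    cases k <;> rfl

/-! ### The machine for the equal sum split problem -/

namespace Split

/-- The stacks of the machine. While the digit of weight `2 ^ i` of an entry is read, `weight` holds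
`2 ^ i` marks; `spare` serves to double it. `reach` holds the bits marking the subset sums
of the entries read so far, `shifted` the same bits shifted by the part of the current entry
that has been read, `merged` is used to combine the two, and `total` holds as many marks as the
sum of all entries. -/
inductive Stack
  | input | output | weight | spare | reach | shifted | merged | total
  deriving DecidableEq

instance : Fintype Stack :=
  ⟨{.input, .output, .weight, .spare, .reach, .shifted, .merged, .total},
    fun k => by cases k <;> decide⟩

/-- The stack alphabets of the machine. -/
def Alphabet : Stack → Type
  | .input => Option Bool
  | _ => Bool

/-- The labels of the machine. -/
inductive Label
  | start | read | double (b : Bool) | restore | clear | merge | spread | halve | clean (b : Bool)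
  deriving DecidableEq, Fintype

/-- The internal state: two registers for letters popped from the stacks. -/
abbrev Registers := Option (Option Bool) × Option Bool

/-- Statements of the machine. -/
abbrev Stmt := TM2.Stmt Alphabet Label Registers

/-- Reset the registers and go to the label `l`. -/
def jump (l : Label) : Stmt := .load (fun _ => (none, none)) (.goto fun _ => l)

/-- The program. For an entry with digits `b₀, b₁, …`, a digit `bᵢ = 1` adds `2 ^ i` zeros to the
shifted bits and `2 ^ i` marks to the total (`double`), and each digit doubles the weight
(`double`, `restore`). The separator after an entry makes the machine form the disjunction of
the bits and the shifted bits (`clear`, `merge`, `spread`). At the end of the input the bit at half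
of the total is looked up (`halve`), and the stacks are emptied (`clean`), as the output convention
of `Turing.haltList` demands. -/
def prog : Label → Stmt
  | .start =>
    .push .weight (fun _ => true) <| .push .reach (fun _ => true) <|
    .push .shifted (fun _ => true) <| jump .read
  | .read =>
    .pop .input (fun v a => (a, v.2)) <|
    .branch (fun v => v.1.isNone) (jump .halve) <|
    .branch (fun v => v.1 == some none) (jump .clear) <|
    .branch (fun v => v.1 == some (some true)) (jump (.double true)) (jump (.double false))
  | .double b =>
    .pop .weight (fun v a => (v.1, a)) <|
    .branch (fun v => v.2.isSome)
      (.push .spare (fun _ => true) <| .push .spare (fun _ => true) <|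
        .branch (fun _ => b)
          (.push .shifted (fun _ => false) <| .push .total (fun _ => true) <| jump (.double b))
          (jump (.double b)))
      (jump .restore)
  | .restore =>
    .pop .spare (fun v a => (v.1, a)) <|
    .branch (fun v => v.2.isSome) (.push .weight (fun _ => true) <| jump .restore) (jump .read)
  | .clear =>
    .pop .weight (fun v a => (v.1, a)) <|
    .branch (fun v => v.2.isSome) (jump .clear) (.push .weight (fun _ => true) <| jump .merge)
  | .merge =>
    .pop .shifted (fun v a => (Option.map some a, v.2)) <| .pop .reach (fun v a => (v.1, a)) <|
    .branch (fun v => v.1.isSome)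
      (.push .merged (fun v => (v.1 == some (some true) || v.2 == some true : Bool)) <|
        jump .merge)
      (jump .spread)
  | .spread =>
    .pop .merged (fun v a => (v.1, a)) <|
    .branch (fun v => v.2.isSome)
      (.push .reach (fun v => v.2.getD false) <| .push .shifted (fun v => v.2.getD false) <|
        jump .spread)
      (jump .read)
  | .halve =>
    .pop .total (fun v a => (v.1, a)) <|
    .branch (fun v => v.2.isSome)
      (.pop .total (fun v a => (v.1, a)) <|
        .branch (fun v => v.2.isSome)
          (.pop .reach (fun v _ => v) <| jump .halve)
          (jump (.clean false)))
      (.pop .reach (fun v a => (v.1, a)) <|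
        .branch (fun v => v.2 == some true) (jump (.clean true)) (jump (.clean false)))
  | .clean b =>
    .pop .weight (fun v a => (v.1, if a.isSome then some true else v.2)) <|
    .pop .reach (fun v a => (v.1, if a.isSome then some true else v.2)) <|
    .pop .shifted (fun v a => (v.1, if a.isSome then some true else v.2)) <|
    .pop .total (fun v a => (v.1, if a.isSome then some true else v.2)) <|
    .branch (fun v => v.2.isSome) (jump (.clean b)) <|
    .push .output (fun _ => b) .halt

/-- The machine deciding whether a sequence can be split into two parts of equal sum. -/
def machine : FinTM2 where
  K := Stack
  k₀ := .input
  k₁ := .output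
  Γ := Alphabet
  Λ := Label
  main := .start
  σ := Registers
  initialState := (none, none)
  Γk₀Fin := inferInstanceAs (Fintype (Option Bool))
  m := prog

/-- The configuration with empty registers and with the stacks `input`, `output`, `weight`, `spare`,
`reach`, `shifted`, `merged`, `total` in this order. -/
def cfg (l : Option Label) (inp : List (Option Bool)) (out P Q R S M T : List Bool) :
    machine.Cfg where
  l := l
  var := (none, none)
  stk
    | .input => inp
    | .output => out
    | .weight => P
    | .spare => Q
    | .reach => R
    | .shifted => S
    | .merged => M
    | .total => T

theorem runs_step {l : Label} {l' : Option Label} {inp inp' : List (Option Bool)}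
    {out P Q R S M T out' P' Q' R' S' M' T' : List Bool}
    (h : TM2.stepAux (prog l) (none, none) (cfg (some l) inp out P Q R S M T).stk
      = (cfg l' inp' out' P' Q' R' S' M' T' : TM2.Cfg Alphabet Label Registers)) :
    Runs machine 1 (cfg (some l) inp out P Q R S M T) (cfg l' inp' out' P' Q' R' S' M' T') :=
  Runs.step (congrArg some h)

theorem cfg_ext {l : Option Label} {inp : List (Option Bool)} {out P Q R S M T : List Bool}
    {c : TM2.Cfg Alphabet Label Registers} (hl : c.l = l) (hv : c.var = (none, none))
    (hi : c.stk .input = inp) (ho : c.stk .output = out) (hP : c.stk .weight = P)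
    (hQ : c.stk .spare = Q) (hR : c.stk .reach = R) (hS : c.stk .shifted = S)
    (hM : c.stk .merged = M) (hT : c.stk .total = T) :
    c = (cfg l inp out P Q R S M T : TM2.Cfg Alphabet Label Registers) := by
  obtain ⟨l', v, s⟩ := c
  obtain rfl : l' = l := hl
  obtain rfl : v = (none, none) := hv
  refine congrArg (TM2.Cfg.mk l' (none, none)) (funext fun k => ?_)
  cases k <;> assumption

variable {inp : List (Option Bool)} {P Q R S M T : List Bool}

theorem runs_start : Runs machine 1 (cfg (some .start) inp [] [] [] [] [] [] [])
    (cfg (some .read) inp [] [true] [] [true] [true] [] []) :=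
  runs_step (cfg_ext rfl rfl rfl rfl rfl rfl rfl rfl rfl rfl)

theorem runs_read_nil : Runs machine 1 (cfg (some .read) [] [] P Q R S M T)
    (cfg (some .halve) [] [] P Q R S M T) :=
  runs_step (cfg_ext rfl rfl rfl rfl rfl rfl rfl rfl rfl rfl)

theorem runs_read_none : Runs machine 1 (cfg (some .read) (none :: inp) [] P Q R S M T)
    (cfg (some .clear) inp [] P Q R S M T) :=
  runs_step (cfg_ext rfl rfl rfl rfl rfl rfl rfl rfl rfl rfl)

theorem runs_read_some (b : Bool) :
    Runs machine 1 (cfg (some .read) (some b :: inp) [] P Q R S M T)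
      (cfg (some (.double b)) inp [] P Q R S M T) := by
  cases b <;> exact runs_step (cfg_ext rfl rfl rfl rfl rfl rfl rfl rfl rfl rfl)

theorem replicate_succ_append {α : Type*} (n : ℕ) (a : α) (l : List α) :
    List.replicate (n + 1) a ++ l = List.replicate n a ++ a :: l := by
  rw [List.replicate_succ', List.append_assoc, List.singleton_append]

theorem runs_double (b : Bool) (p : ℕ) :
    Runs machine (p + 1)
      (cfg (some (.double b)) inp [] (List.replicate p true) Q R S M T)
      (cfg (some .restore) inp [] [] (List.replicate (2 * p) true ++ Q) R
        (List.replicate (b.toNat * p) false ++ S) M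
        (List.replicate (b.toNat * p) true ++ T)) := by
  induction p generalizing Q S T with
  | zero =>
    simp only [mul_zero, List.replicate_zero, List.nil_append]
    exact runs_step (cfg_ext rfl rfl rfl rfl rfl rfl rfl rfl rfl rfl)
  | succ p ih =>
    cases b
    · have h : Runs machine 1
          (cfg (some (.double false)) inp [] (List.replicate (p + 1) true) Q R S M T)
          (cfg (some (.double false)) inp [] (List.replicate p true) (true :: true :: Q)
            R S M T) :=
        runs_step (cfg_ext rfl rfl rfl rfl rfl rfl rfl rfl rfl rfl)
      have h' := h.trans (ih (Q := true :: true :: Q))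
      simp only [Bool.toNat_false, zero_mul, List.replicate_zero, List.nil_append] at h' ⊢
      rw [show 2 * (p + 1) = 2 * p + 1 + 1 by ring, replicate_succ_append, replicate_succ_append]
      exact h'.mono (by omega)
    · have h : Runs machine 1
          (cfg (some (.double true)) inp [] (List.replicate (p + 1) true) Q R S M T)
          (cfg (some (.double true)) inp [] (List.replicate p true) (true :: true :: Q)
            R (false :: S) M (true :: T)) :=
        runs_step (cfg_ext rfl rfl rfl rfl rfl rfl rfl rfl rfl rfl)
      have h' := h.trans (ih (Q := true :: true :: Q) (S := false :: S) (T := true :: T))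
      simp only [Bool.toNat_true, one_mul] at h' ⊢
      rw [show 2 * (p + 1) = 2 * p + 1 + 1 by ring, replicate_succ_append,
        replicate_succ_append, replicate_succ_append, replicate_succ_append]
      exact h'.mono (by omega)

theorem runs_restore (q p : ℕ) :
    Runs machine (q + 1)
      (cfg (some .restore) inp [] (List.replicate p true) (List.replicate q true) R S M T)
      (cfg (some .read) inp [] (List.replicate (q + p) true) [] R S M T) := by
  induction q generalizing p with
  | zero =>
    rw [zero_add p]
    exact runs_step (cfg_ext rfl rfl rfl rfl rfl rfl rfl rfl rfl rfl)
  | succ q ih =>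
    have h : Runs machine 1
        (cfg (some .restore) inp [] (List.replicate p true) (List.replicate (q + 1) true) R S M T)
        (cfg (some .restore) inp [] (List.replicate (p + 1) true) (List.replicate q true)
          R S M T) :=
      runs_step (cfg_ext rfl rfl rfl rfl rfl rfl rfl rfl rfl rfl)
    have h' := (h.trans (ih (p + 1))).mono (n := q + 1 + 1) (by omega)
    rwa [show q + (p + 1) = q + 1 + p by ring] at h'

/-- Reading the digits of an entry, with `p` marks for the weight of the first one. The weights
form a geometric progression, which makes the time linear in the value of the entry. -/
theorem runs_bits (bs : List Bool) (p : ℕ) :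
    Runs machine (3 * p * (2 ^ bs.length - 1) + 3 * bs.length)
      (cfg (some .read) (bs.map some ++ inp) [] (List.replicate p true) [] R S M T)
      (cfg (some .read) inp [] (List.replicate (p * 2 ^ bs.length) true) [] R
        (List.replicate (p * ofBits bs) false ++ S) M
        (List.replicate (p * ofBits bs) true ++ T)) := by
  induction bs generalizing p S T with
  | nil => simpa [ofBits] using Runs.refl _
  | cons b bs ih =>
    have h1 := runs_read_some (inp := bs.map some ++ inp) (P := List.replicate p true) (Q := [])
      (R := R) (S := S) (M := M) (T := T) b
    have h2 := runs_double (inp := bs.map some ++ inp) (Q := []) (R := R) (S := S) (M := M)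
      (T := T) b p
    have h3 := runs_restore (inp := bs.map some ++ inp) (R := R)
      (S := List.replicate (b.toNat * p) false ++ S) (M := M)
      (T := List.replicate (b.toNat * p) true ++ T) (2 * p) 0
    rw [List.append_nil] at h2
    have h4 := ((h1.trans h2).trans h3).trans (ih (S := List.replicate (b.toNat * p) false ++ S)
      (T := List.replicate (b.toNat * p) true ++ T) (2 * p + 0))
    rw [← List.append_assoc, ← List.append_assoc, List.replicate_append_replicate,
      List.replicate_append_replicate,
      show (2 * p + 0) * ofBits bs + b.toNat * p = p * ofBits (b :: bs) by rw [ofBits]; ring,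
      show (2 * p + 0) * 2 ^ bs.length = p * 2 ^ (b :: bs).length by
        rw [List.length_cons, pow_succ]; ring] at h4
    refine h4.mono ?_
    rw [List.length_cons, pow_succ]
    obtain ⟨m, hm⟩ := Nat.exists_eq_succ_of_ne_zero (pow_ne_zero bs.length (two_ne_zero (α := ℕ)))
    rw [hm, show m.succ * 2 - 1 = 2 * m + 1 by omega, Nat.succ_sub_one]
    nlinarith

theorem runs_clear : Runs machine (P.length + 1) (cfg (some .clear) inp [] P Q R S M T)
    (cfg (some .merge) inp [] [true] Q R S M T) := by
  induction P with
  | nil => exact runs_step (cfg_ext rfl rfl rfl rfl rfl rfl rfl rfl rfl rfl)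
  | cons a P ih =>
    have h : Runs machine 1 (cfg (some .clear) inp [] (a :: P) Q R S M T)
        (cfg (some .clear) inp [] P Q R S M T) :=
      runs_step (cfg_ext rfl rfl rfl rfl rfl rfl rfl rfl rfl rfl)
    exact (h.trans ih).mono (by simp; omega)

theorem runs_merge (hRS : R.length ≤ S.length) :
    Runs machine (S.length + 1) (cfg (some .merge) inp [] P Q R S M T)
      (cfg (some .spread) inp [] P Q [] [] ((zipOr S R).reverse ++ M) T) := by
  induction S generalizing R M with
  | nil =>
    obtain rfl : R = [] := by simpa using hRS
    exact runs_step (cfg_ext rfl rfl rfl rfl rfl rfl rfl rfl rfl rfl)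
  | cons s S ih =>
    have h : Runs machine 1 (cfg (some .merge) inp [] P Q R (s :: S) M T)
        (cfg (some .merge) inp [] P Q R.tail S ((s || R.head? == some true) :: M) T) := by
      refine runs_step (cfg_ext rfl rfl rfl rfl rfl rfl rfl rfl ?_ rfl)
      cases s <;> rfl
    have h' := (h.trans (ih (R := R.tail) (M := (s || R.head? == some true) :: M)
      (by simpa using hRS))).mono (n := (s :: S).length + 1) (by simp; omega)
    simpa [zipOr] using h'

theorem runs_spread : Runs machine (M.length + 1) (cfg (some .spread) inp [] P Q R S M T)
    (cfg (some .read) inp [] P Q (M.reverse ++ R) (M.reverse ++ S) [] T) := by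
  induction M generalizing R S with
  | nil => exact runs_step (cfg_ext rfl rfl rfl rfl rfl rfl rfl rfl rfl rfl)
  | cons a M ih =>
    have h : Runs machine 1 (cfg (some .spread) inp [] P Q R S (a :: M) T)
        (cfg (some .spread) inp [] P Q (a :: R) (a :: S) M T) :=
      runs_step (cfg_ext rfl rfl rfl rfl rfl rfl rfl rfl rfl rfl)
    have h' := (h.trans (ih (R := a :: R) (S := a :: S))).mono (n := (a :: M).length + 1)
      (by simp; omega)
    simpa using h'

/-- Two marks are taken from the total for each bit dropped, so half of the total is never computed.
The remainders `R'` and `T'` matter only through their lengths. -/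
theorem runs_halve : ∃ R' T', R'.length ≤ R.length ∧ T'.length ≤ T.length ∧
    Runs machine (T.length + 1) (cfg (some .halve) inp [] P Q R S M T)
      (cfg (some (.clean (bitAtHalf T.length R))) inp [] P Q R' S M T') := by
  induction hT : T.length using Nat.strong_induction_on generalizing R T with
  | _ n ih =>
    rcases T with _ | ⟨a, _ | ⟨b, T⟩⟩
    · obtain rfl : n = 0 := hT.symm
      refine ⟨R.tail, [], by simp, by simp, runs_step (cfg_ext ?_ ?_ ?_ ?_ ?_ ?_ ?_ ?_ ?_ ?_)⟩
      all_goals rcases R with _ | ⟨_ | _, R⟩ <;> rfl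
    · obtain rfl : n = 1 := hT.symm
      exact ⟨R, [], le_rfl, by simp,
        (runs_step (cfg_ext rfl rfl rfl rfl rfl rfl rfl rfl rfl rfl)).mono (by omega)⟩
    · obtain rfl : n = T.length + 2 := hT.symm
      have h : Runs machine 1 (cfg (some .halve) inp [] P Q R S M (a :: b :: T))
          (cfg (some .halve) inp [] P Q R.tail S M T) :=
        runs_step (cfg_ext rfl rfl rfl rfl rfl rfl rfl rfl rfl rfl)
      obtain ⟨R', T', hR', hT', h'⟩ := ih T.length (by omega) (R := R.tail) (T := T) rfl
      exact ⟨R', T', hR'.trans (by simp), hT'.trans (by omega), (h.trans h').mono (by omega)⟩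

theorem runs_clean (b : Bool) :
    Runs machine (P.length + R.length + S.length + T.length + 1)
      (cfg (some (.clean b)) [] [] P [] R S [] T) (cfg none [] [b] [] [] [] [] [] []) := by
  induction hn : P.length + R.length + S.length + T.length using Nat.strong_induction_on
    generalizing P R S T with
  | _ n ih =>
    by_cases h0 : n = 0
    · obtain rfl : P = [] := List.eq_nil_of_length_eq_zero (by omega)
      obtain rfl : R = [] := List.eq_nil_of_length_eq_zero (by omega)
      obtain rfl : S = [] := List.eq_nil_of_length_eq_zero (by omega)
      obtain rfl : T = [] := List.eq_nil_of_length_eq_zero (by omega)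
      exact (runs_step (cfg_ext rfl rfl rfl rfl rfl rfl rfl rfl rfl rfl)).mono (by omega)
    · have h : Runs machine 1 (cfg (some (.clean b)) [] [] P [] R S [] T)
          (cfg (some (.clean b)) [] [] P.tail [] R.tail S.tail [] T.tail) := by
        apply runs_step
        rcases P with _ | ⟨x, P⟩ <;> rcases R with _ | ⟨y, R⟩ <;> rcases S with _ | ⟨z, S⟩ <;>
          rcases T with _ | ⟨w, T⟩ <;>
          first
          | exact absurd hn.symm h0
          | exact cfg_ext rfl rfl rfl rfl rfl rfl rfl rfl rfl rfl
      have hlt : P.tail.length + R.tail.length + S.tail.length + T.tail.length < n := by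
        simp only [List.length_tail]; omega
      exact (h.trans (ih _ hlt rfl)).mono (by omega)

/-- Reading an entry `d` and its separator performs one step of the dynamic program. -/
theorem runs_entry (d : ℕ) :
    Runs machine (16 * d + 2 * R.length + 5)
      (cfg (some .read) ((Computability.encodeNat d).map some ++ none :: inp) [] [true] [] R R [] T)
      (cfg (some .read) inp [] [true] [] (addEntry R d) (addEntry R d) []
        (List.replicate d true ++ T)) := by
  have hpow := two_pow_length_encodeNat_le d
  have hlen : (Computability.encodeNat d).length < 2 ^ (Computability.encodeNat d).length :=
    Nat.lt_two_pow_self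
  have h1 := runs_bits (inp := none :: inp) (R := R) (S := R) (M := []) (T := T)
    (Computability.encodeNat d) 1
  rw [one_mul, one_mul, ofBits_encodeNat] at h1
  have h2 := runs_merge (inp := inp) (P := [true]) (Q := []) (R := R)
    (S := List.replicate d false ++ R) (M := []) (T := List.replicate d true ++ T) (by simp)
  have h3 := runs_spread (inp := inp) (P := [true]) (Q := []) (R := []) (S := [])
    (M := (zipOr (List.replicate d false ++ R) R).reverse ++ []) (T := List.replicate d true ++ T)
  have h := (((h1.trans runs_read_none).trans runs_clear).trans h2).trans h3
  simp only [List.append_nil, List.reverse_reverse] at h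
  refine h.mono ?_
  simp only [List.length_reverse, length_zipOr, List.length_append, List.length_replicate]
  omega

/-- Reading the whole input. The bound `B` on the final number of bits bounds the cost of merging
after each entry. -/
theorem runs_entries (D : List ℕ) (B : ℕ) (hB : D.sum + R.length ≤ B) :
    Runs machine (16 * D.sum + D.length * (2 * B + 5))
      (cfg (some .read) (encodeSeq D) [] [true] [] R R [] T)
      (cfg (some .read) [] [] [true] [] (D.foldl addEntry R) (D.foldl addEntry R) []
        (List.replicate D.sum true ++ T)) := by
  induction D generalizing R T with
  | nil => simpa [encodeSeq] using Runs.refl _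
  | cons d D ih =>
    rw [List.sum_cons] at hB
    have h1 := runs_entry (inp := encodeSeq D) (R := R) (T := T) d
    have h2 := ih (R := addEntry R d) (T := List.replicate d true ++ T)
      (by rw [length_addEntry]; omega)
    have h := h1.trans h2
    rw [← List.append_assoc, List.replicate_append_replicate, add_comm D.sum] at h
    have he : encodeSeq (d :: D)
        = (Computability.encodeNat d).map some ++ none :: encodeSeq D := by
      simp [encodeSeq]
    rw [he, List.foldl_cons, List.sum_cons]
    refine h.mono ?_
    rw [List.length_cons, add_one_mul D.length]
    omega

theorem runs_machine (D : List ℕ) :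
    Runs machine (D.length * (2 * D.sum + 7) + 20 * D.sum + 7)
      (cfg (some .start) (encodeSeq D) [] [] [] [] [] [] [])
      (cfg none [] [bitAtHalf D.sum (D.foldl addEntry [true])] [] [] [] [] [] []) := by
  have h1 := runs_start (inp := encodeSeq D)
  have h2 := runs_entries (R := [true]) (T := []) D (D.sum + 1) le_rfl
  obtain ⟨R', T', hR', hT', h3⟩ := runs_halve (inp := []) (P := [true]) (Q := [])
    (R := D.foldl addEntry [true]) (S := D.foldl addEntry [true]) (M := [])
    (T := List.replicate D.sum true ++ [])
  have h4 := runs_clean (P := [true]) (R := R') (S := D.foldl addEntry [true]) (T := T')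
    (bitAtHalf (List.replicate D.sum true ++ []).length (D.foldl addEntry [true]))
  have h := (((h1.trans h2).trans runs_read_nil).trans h3).trans h4
  simp only [List.append_nil, List.length_replicate] at h hT'
  refine h.mono ?_
  rw [length_foldl_addEntry] at *
  simp only [List.length_singleton] at *
  nlinarith

end Split

theorem inP_hasEqualSumSplit : InP {D : List ℕ | ∀ d ∈ D, d ≤ D.length} HasEqualSumSplit := by
  classical
  refine inP_of_runs Split.machine (Equiv.refl _) (Equiv.refl _)
    (Polynomial.X * (2 * Polynomial.X ^ 2 + 7) + 20 * Polynomial.X ^ 2 + 7) fun D hD =>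
    ⟨bitAtHalf D.sum (D.foldl addEntry [true]), bitAtHalf_foldl_addEntry, ?_⟩
  have hsum : D.sum ≤ (encodeSeq D).length ^ 2 := by
    have h1 := List.sum_le_card_nsmul D D.length hD
    have h2 := length_le_length_encodeSeq D
    rw [smul_eq_mul] at h1
    nlinarith
  have hrun := (Split.runs_machine D).mono (n := (Polynomial.X * (2 * Polynomial.X ^ 2 + 7)
      + 20 * Polynomial.X ^ 2 + 7 : Polynomial ℕ).eval (encodeSeq D).length) (by
    simp only [Polynomial.eval_add, Polynomial.eval_mul, Polynomial.eval_pow, Polynomial.eval_X,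
      Polynomial.eval_ofNat]
    gcongr
    exact length_le_length_encodeSeq D)
  convert hrun using 1
  · refine congrArg (TM2.Cfg.mk (some Split.Label.start) (none, none)) (funext fun k => ?_)
    cases k
    · exact List.map_id _
    all_goals rfl
  · refine congrArg (TM2.Cfg.mk none (none, none)) (funext fun k => ?_)
    cases k <;> rfl

end BDR

theorem mainTheorem1 (c₁ c₂ : ℝ) :
    (0 ≤ c₁ → c₁ ≤ c₂ → c₂ ≤ (√(c₁ * (c₁ + 4)) - c₁) / 2 →
      (∀ D ∈ BDR.Instances c₁ c₂, BDR.HasBipartiteRealization D ↔ BDR.HasEqualSumSplit D) ∧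
      BDR.InP (BDR.Instances c₁ c₂) BDR.HasBipartiteRealization) ∧
    BDR.InP {D : List ℕ | ∀ d ∈ D, d ≤ D.length} BDR.HasEqualSumSplit ∧
    (1 / 2 < c₁ → c₁ ≤ c₂ →
      (∀ D ∈ BDR.Instances c₁ c₂, D ≠ [] → ¬ BDR.HasBipartiteRealization D) ∧
      BDR.InP (BDR.Instances c₁ c₂) BDR.HasBipartiteRealization) := by
  refine ⟨fun h0 h12 h => ?_, BDR.inP_hasEqualSumSplit, fun h _ => ?_⟩
  · have hc := BDR.mul_self_le_of_le_sqrt h0 h12 h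
    have hiff : ∀ D ∈ BDR.Instances c₁ c₂,
        BDR.HasBipartiteRealization D ↔ BDR.HasEqualSumSplit D := fun D hD =>
      ⟨BDR.HasBipartiteRealization.hasEqualSumSplit,
        BDR.HasEqualSumSplit.hasBipartiteRealization h0 h12 hc hD⟩
    refine ⟨hiff, (BDR.inP_hasEqualSumSplit.mono fun D hD d hd => ?_).congr
      fun D hD => (hiff D hD).symm⟩
    -- the entries are at most `n`, as the split problem requires
    have h1 : c₂ ≤ 1 := by nlinarith
    have h2 : (d : ℝ) ≤ D.length :=
      (hD d hd).2.trans (mul_le_of_le_one_left (Nat.cast_nonneg _) h1)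
    exact_mod_cast h2
  · have hnot : ∀ D ∈ BDR.Instances c₁ c₂, D ≠ [] → ¬ BDR.HasBipartiteRealization D :=
      fun D hD hne => BDR.not_hasBipartiteRealization h hD hne
    refine ⟨hnot, (BDR.inP_eq_nil _).congr fun D hD => ⟨?_, fun hr => ?_⟩⟩
    · rintro rfl
      exact BDR.hasBipartiteRealization_nil
    · by_contra hne
      exact hnot D hD hne hr
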